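/- Let $I_1=\{m+n\mathrm{i} : m\in\mathbb N,\ n\in\mathbb Z\}$ and $I_2=\{m+n\mathrm{i} : m\in\mathbb N,\ n\in\mathbb Z,\ n<0\}$, where $\mathbb N=\{1,2,3,\dots\}$, and for $b\in\mathbb C$ put $\theta_b(z)=1/(z+b)$. Let $D=\{x+\mathrm{i}y : (x-\tfrac12)^2+y^2\le \tfrac14\}$, and let $U\subset\mathbb C$ be an open set with closure $\bar U\supset D$ such that $0\le x\le 1$ and $|y|\le \tfrac12$ for all $x+\mathrm{i}y\in\bar U$. Let $s>1$ and $R>2$. For $B=I_1$ or $B=I_2$ let $L_s$ be the operator $$(L_sf)(z)=\sum_{b\in B}\frac{f(\theta_b(z))}{|z+b|^{2s}},\qquad z\in\bar U,$$ on the space $C_{\mathbb R}(\bar U)$ of continuous real functions on $\bar U$, and let $v_s\in C_{\mathbb R}(\bar U)$ be any strictly positive eigenfunction of $L_s$, that is, $v_s>0$ on $\bar U$ and $L_sv_s=c\,v_s$ for some real $c$. Then for every $z\in\bar U$ the sums below converge and satisfy the following bounds. If $B=I_1$, $$\sum_{b\in I_1,\ |b|>R}\frac{v_s(\theta_b(z))}{|z+b|^{2s}}\le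 \exp\Big(\frac{s}{\sqrt{R^2-R}}\Big)\Big(\frac{R}{R-1}\Big)^s\left[\frac{1}{2s-1}\Big(\frac{1}{R-1}\Big)^{2s-1}+\frac{\pi}{2}\,\frac{1}{s-1}\Big(\frac{1}{R-\sqrt2}\Big)^{2s-2}\right]v_s(0).$$ If $B=I_2$, $$\sum_{b\in I_2,\ |b|>R}\frac{v_s(\theta_b(z))}{|z+b|^{2s}}\le \exp\Big(\frac{s}{\sqrt{R^2-R}}\Big)\Big(\frac{R}{R-1}\Big)^s\left[\frac{\pi}{4}\,\frac{1}{s-1}\Big(\frac{1}{R-\sqrt2}\Big)^{2s-2}\right]v_s(0).$$ -/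

import Mathlib

/-- The index set `I₁ = {m + n i : m ∈ ℕ, m ≥ 1, n ∈ ℤ}`. -/
def indexSetOne : Set ℂ :=
  {b | ∃ (m : ℕ) (n : ℤ), 1 ≤ m ∧ b = (m : ℂ) + (n : ℂ) * Complex.I}

/-- The index set `I₂ = {m + n i : m ∈ ℕ, m ≥ 1, n ∈ ℤ, n < 0}`. -/
def indexSetTwo : Set ℂ :=
  {b | ∃ (m : ℕ) (n : ℤ), 1 ≤ m ∧ n < 0 ∧ b = (m : ℂ) + (n : ℂ) * Complex.I}

/-- The closed disc `D = {(x, y) : (x - 1/2)² + y² ≤ 1/4}`. -/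
def baseDisc : Set ℂ :=
  {z | (z.re - 1 / 2) ^ 2 + z.im ^ 2 ≤ 1 / 4}

/-- The Möbius transform `θ_b z = 1 / (z + b)`. -/
noncomputable def moebiusTheta (b z : ℂ) : ℂ := 1 / (z + b)

/-- The `b`-th term `f (θ_b z) / |z + b|^{2s}` of `(L_s f)(z)`. The weight `1 / |z + b|^{2s}` is
`|θ_b'(z)|^s`. -/
noncomputable def transferTerm (s : ℝ) (f : ℂ → ℝ) (z b : ℂ) : ℝ :=
  1 / ‖z + b‖ ^ (2 * s) * f (moebiusTheta b z)

/-- The operator `(L_s f)(z) = ∑_{b ∈ B} f (θ_b z) / |z + b|^{2s}`. -/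
noncomputable def transferOp (B : Set ℂ) (s : ℝ) (f : ℂ → ℝ) (z : ℂ) : ℝ :=
  ∑' b : B, transferTerm s f z b

/-- `v` restricts to a strictly positive eigenfunction of `L_s` in `C_ℝ(K)`. When `θ_b` maps `K`
into `K` for all `b ∈ B`, only the values of `v` on `K` matter. -/
def IsPositiveEigenfunction (B : Set ℂ) (s : ℝ) (K : Set ℂ) (v : ℂ → ℝ) : Prop :=
  ContinuousOn v K ∧ (∀ z ∈ K, 0 < v z) ∧
    ∃ c : ℝ, ∀ z ∈ K, Summable (fun b : B => transferTerm s v z b) ∧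
      transferOp B s v z = c * v z

/-! The core is a Harnack inequality (`IsPositiveEigenfunction.harnack`). If `|1 + τ z| ≤ H |1 + τ
w|` on `D`, then `θ_b` carries this to the image points with `H` multiplied by `|w + b| / |z + b|`,
whose power `2s` exactly converts the weight at `w` into the weight at `z`. Iterating the eigenvalue
equation moves the points together, uniform continuity compares `v` there, and the eigenvalue
cancels. With `z = 0` this gives `v w ≤ exp(s|w|) v 0`. Each tail term is then at most a constant
times `|b|^(-2s)`, and the lattice sum is bounded by integrals over unit cells. -/

/-! ### The disc `D` as the inverse of the half-plane `Re ≥ 1`, and contraction by `θ_b`. -/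

lemma one_div_mem_baseDisc {ζ : ℂ} (h : 1 ≤ ζ.re) : 1 / ζ ∈ baseDisc := by
  have hN : 0 < Complex.normSq ζ := by
    rw [Complex.normSq_pos]; rintro rfl; norm_num at h
  have hN' := Complex.normSq_apply ζ
  simp only [baseDisc, Set.mem_ofPred_eq, one_div, Complex.inv_re, Complex.inv_im]
  have : (ζ.re / Complex.normSq ζ - 2⁻¹) ^ 2 + (-ζ.im / Complex.normSq ζ) ^ 2
      = 4⁻¹ - (ζ.re - 1) / Complex.normSq ζ := by
    field_simp
    rw [hN']; ring
  rw [this]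
  have : 0 ≤ (ζ.re - 1) / Complex.normSq ζ := div_nonneg (by linarith) hN.le
  linarith

lemma zero_mem_baseDisc : (0 : ℂ) ∈ baseDisc := by
  norm_num [baseDisc]

lemma re_nonneg_of_mem_baseDisc {τ : ℂ} (h : τ ∈ baseDisc) : 0 ≤ τ.re := by
  simp only [baseDisc, Set.mem_ofPred_eq] at h
  nlinarith [sq_nonneg τ.im, sq_nonneg τ.re]

lemma one_le_inv_re_of_mem_baseDisc {τ : ℂ} (h : τ ∈ baseDisc) (h0 : τ ≠ 0) : 1 ≤ (τ⁻¹).re := by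
  have hN : 0 < Complex.normSq τ := Complex.normSq_pos.2 h0
  simp only [baseDisc, Set.mem_ofPred_eq] at h
  rw [Complex.inv_re, le_div_iff₀ hN, Complex.normSq_apply]
  nlinarith

lemma sq_norm_eq (z : ℂ) : ‖z‖ ^ 2 = z.re ^ 2 + z.im ^ 2 := by
  rw [← Complex.normSq_eq_norm_sq, Complex.normSq_apply]; ring

lemma ne_zero_of_one_le_re {z : ℂ} (h : 1 ≤ z.re) : z ≠ 0 := by
  rintro rfl; norm_num at h

/-- In the strip, this makes every `θ_b` at least halve `‖w - z‖ / (‖w + 1‖ ‖z + 1‖)`. -/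
lemma sqrt_two_mul_norm_add_one_le {w b : ℂ} (h0 : 0 ≤ w.re) (h1 : w.re ≤ 1) (hi : |w.im| ≤ 1 / 2)
    (hb : 1 ≤ b.re) : √2 * ‖w + 1‖ ≤ ‖w + b + 1‖ := by
  apply le_of_sq_le_sq _ (norm_nonneg _)
  rw [mul_pow, Real.sq_sqrt (by norm_num), sq_norm_eq, sq_norm_eq]
  simp only [Complex.add_re, Complex.add_im, Complex.one_re, Complex.one_im]
  have := abs_le.1 hi
  have h2 : w.im ^ 2 ≤ 1 / 4 := by nlinarith
  -- With `x = Re w`, `(x + 2)² - 2(x + 1)² = 2 - x² ≥ 1` absorbs `2 (Im w)² ≤ 1/2`.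
  have h3 : (w.re + 2) ^ 2 ≤ (w.re + b.re + 1) ^ 2 := by
    apply pow_le_pow_left₀ <;> linarith
  nlinarith [sq_nonneg (w.im + b.im)]

/-- The denominators `w + b`, `z + b` cancel from the quotient, leaving `|w - z| / (|w + b + 1| |z +
b + 1|)`; each factor below gains `√2`. -/
lemma moebiusTheta_contraction {w z b : ℂ} {η : ℝ}
    (hw : 0 ≤ w.re ∧ w.re ≤ 1 ∧ |w.im| ≤ 1 / 2) (hz : 0 ≤ z.re ∧ z.re ≤ 1 ∧ |z.im| ≤ 1 / 2)
    (hb : 1 ≤ b.re) (hη : 0 ≤ η) (h : ‖w - z‖ ≤ 2 * η * (‖w + 1‖ * ‖z + 1‖)) :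
    ‖moebiusTheta b w - moebiusTheta b z‖ ≤
      η * (‖moebiusTheta b w + 1‖ * ‖moebiusTheta b z + 1‖) := by
  have hwb : w + b ≠ 0 := ne_zero_of_one_le_re (by simp; linarith [hw.1])
  have hzb : z + b ≠ 0 := ne_zero_of_one_le_re (by simp; linarith [hz.1])
  have e1 : moebiusTheta b w - moebiusTheta b z = -(w - z) / ((w + b) * (z + b)) := by
    unfold moebiusTheta; field_simp; ring
  have e2 : moebiusTheta b w + 1 = (w + b + 1) / (w + b) := by
    unfold moebiusTheta; field_simp; ring
  have e3 : moebiusTheta b z + 1 = (z + b + 1) / (z + b) := by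
    unfold moebiusTheta; field_simp; ring
  rw [e1, e2, e3, norm_div, norm_div, norm_div, norm_neg, norm_mul, div_mul_div_comm, ← mul_div_assoc]
  apply div_le_div_of_nonneg_right _ (by positivity)
  have a1 := sqrt_two_mul_norm_add_one_le hw.1 hw.2.1 hw.2.2 hb
  have a2 := sqrt_two_mul_norm_add_one_le hz.1 hz.2.1 hz.2.2 hb
  have a3 := mul_le_mul a1 a2 (by positivity) (by positivity)
  have a4 : (√2 * ‖w + 1‖) * (√2 * ‖z + 1‖) = 2 * (‖w + 1‖ * ‖z + 1‖) := by
    rw [mul_mul_mul_comm, Real.mul_self_sqrt (by norm_num)]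
  rw [a4] at a3
  calc ‖w - z‖ ≤ η * (2 * (‖w + 1‖ * ‖z + 1‖)) := by linarith
    _ ≤ _ := by gcongr

/-! ### Harnack inequality for positive eigenfunctions. -/

section Eigenfunction

variable {B K : Set ℂ} {s : ℝ} {v : ℂ → ℝ}

lemma moebiusTheta_mem {z b : ℂ} (hD : baseDisc ⊆ K) (hz : 0 ≤ z.re) (hb : 1 ≤ b.re) :
    moebiusTheta b z ∈ K :=
  hD (one_div_mem_baseDisc (by simp; linarith))

/-- The comparison of `|1 + τ z|` with `|1 + τ w|`, uniform in `τ ∈ D`, is carried along by `θ_b`. -/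
lemma moebiusTheta_ratio {w z b : ℂ} {H : ℝ} (hw : 0 ≤ w.re) (hz : 0 ≤ z.re) (hb : 1 ≤ b.re)
    (h : ∀ τ ∈ baseDisc, ‖1 + τ * z‖ ≤ H * ‖1 + τ * w‖) :
    ∀ τ ∈ baseDisc, ‖1 + τ * moebiusTheta b z‖ ≤
      H * (‖w + b‖ / ‖z + b‖) * ‖1 + τ * moebiusTheta b w‖ := by
  intro τ hτ
  have hwb : w + b ≠ 0 := ne_zero_of_one_le_re (by simp; linarith)
  have hzb : z + b ≠ 0 := ne_zero_of_one_le_re (by simp; linarith)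
  have hre : 1 ≤ (b + τ).re := by
    simp only [Complex.add_re]; linarith [re_nonneg_of_mem_baseDisc hτ]
  have hbτ : b + τ ≠ 0 := ne_zero_of_one_le_re hre
  -- The hypothesis at `1 / (b + τ)` compares `|z + b + τ|` with `|w + b + τ|`.
  have key := h _ (one_div_mem_baseDisc hre)
  have e1 : 1 + 1 / (b + τ) * z = (z + b + τ) / (b + τ) := by field_simp; ring
  have e2 : 1 + 1 / (b + τ) * w = (w + b + τ) / (b + τ) := by field_simp; ring
  have e3 : 1 + τ * moebiusTheta b z = (z + b + τ) / (z + b) := by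
    unfold moebiusTheta; field_simp
  have e4 : 1 + τ * moebiusTheta b w = (w + b + τ) / (w + b) := by
    unfold moebiusTheta; field_simp
  rw [e1, e2, norm_div, norm_div, ← mul_div_assoc,
    div_le_div_iff_of_pos_right (norm_pos_iff.2 hbτ)] at key
  rw [e3, e4, norm_div, norm_div]
  have p1 := norm_pos_iff.2 hwb
  have p2 := norm_pos_iff.2 hzb
  have e5 : H * (‖w + b‖ / ‖z + b‖) * (‖w + b + τ‖ / ‖w + b‖) = H * ‖w + b + τ‖ / ‖z + b‖ := by
    field_simp
  rw [e5]
  gcongr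

/-- Each use of the eigenvalue equation halves the allowed distance, so `n` uses reduce to `h0`. The
loss `1 + ε` is paid only once, at the bottom of the induction. -/
lemma IsPositiveEigenfunction.le_of_near (hv : IsPositiveEigenfunction B s K v)
    (hs : 0 < s) (hB : ∀ b ∈ B, 1 ≤ b.re) (hne : B.Nonempty)
    (hD : baseDisc ⊆ K) (hK : ∀ z ∈ K, 0 ≤ z.re ∧ z.re ≤ 1 ∧ |z.im| ≤ 1 / 2)
    {ε η : ℝ} (hε : 0 < ε) (hη : 0 < η)
    (h0 : ∀ w ∈ K, ∀ z ∈ K, ‖w - z‖ ≤ η * (‖w + 1‖ * ‖z + 1‖) → v w ≤ (1 + ε) * v z) (n : ℕ) :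
    ∀ w ∈ K, ∀ z ∈ K, ∀ H : ℝ, ‖w - z‖ ≤ η * 2 ^ n * (‖w + 1‖ * ‖z + 1‖) →
      (∀ τ ∈ baseDisc, ‖1 + τ * z‖ ≤ H * ‖1 + τ * w‖) →
      v w ≤ (1 + ε) * H ^ (2 * s) * v z := by
  have one_le : ∀ {w z : ℂ} {H : ℝ}, (∀ τ ∈ baseDisc, ‖1 + τ * z‖ ≤ H * ‖1 + τ * w‖) → 1 ≤ H := by
    intro w z H h
    simpa using h 0 zero_mem_baseDisc
  induction n with
  | zero =>
    intro w hw z hz H hd hH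
    have h1 := h0 w hw z hz (by simpa using hd)
    have h2 : 1 ≤ H ^ (2 * s) := Real.one_le_rpow (one_le hH) (by positivity)
    have h3 := hv.2.1 z hz
    calc v w ≤ (1 + ε) * 1 * v z := by simpa using h1
      _ ≤ _ := by gcongr
  | succ n ih =>
    intro w hw z hz H hd hH
    obtain ⟨-, hpos, c, hc⟩ := hv
    obtain ⟨sw, cw⟩ := hc w hw
    obtain ⟨sz, cz⟩ := hc z hz
    have H1 := one_le hH
    have nz : ∀ {u b : ℂ}, u ∈ K → b ∈ B → 0 < ‖u + b‖ := fun {u b} hu hb =>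
      norm_pos_iff.2 (ne_zero_of_one_le_re (by
        simp only [Complex.add_re]; linarith [(hK u hu).1, hB b hb]))
    have term : ∀ b : B, transferTerm s v w b ≤ (1 + ε) * H ^ (2 * s) * transferTerm s v z b := by
      rintro ⟨b, hb⟩
      have hw0 := nz hw hb
      have hz0 := nz hz hb
      have hd' := moebiusTheta_contraction (hK w hw) (hK z hz) (hB b hb)
        (by positivity : 0 ≤ η * 2 ^ n) (hd.trans (le_of_eq (by ring)))
      have := ih _ (moebiusTheta_mem hD (hK w hw).1 (hB b hb)) _
        (moebiusTheta_mem hD (hK z hz).1 (hB b hb)) _ hd'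
        (moebiusTheta_ratio (hK w hw).1 (hK z hz).1 (hB b hb) hH)
      rw [Real.mul_rpow (by linarith) (by positivity),
        Real.div_rpow (by positivity) (by positivity)] at this
      have hw1 : 0 < ‖w + b‖ ^ (2 * s) := by positivity
      have hz1 : 0 < ‖z + b‖ ^ (2 * s) := by positivity
      simp only [transferTerm]
      calc 1 / ‖w + b‖ ^ (2 * s) * v (moebiusTheta b w)
          ≤ 1 / ‖w + b‖ ^ (2 * s) * ((1 + ε) * (H ^ (2 * s) *
            (‖w + b‖ ^ (2 * s) / ‖z + b‖ ^ (2 * s))) * v (moebiusTheta b z)) := by gcongr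
        _ = _ := by field_simp
    have hsum : transferOp B s v w ≤ (1 + ε) * H ^ (2 * s) * transferOp B s v z := by
      unfold transferOp
      rw [← tsum_mul_left]
      exact sw.tsum_le_tsum term (sz.mul_left _)
    have cpos : 0 < c := by
      have hp : ∀ b : B, 0 < transferTerm s v z b := by
        rintro ⟨b, hb⟩
        have hz0 := nz hz hb
        have := hpos _ (moebiusTheta_mem hD (hK z hz).1 (hB b hb))
        simp only [transferTerm]
        positivity
      obtain ⟨b, hb⟩ := hne
      have : 0 < transferOp B s v z := sz.tsum_pos (fun b => (hp b).le) ⟨b, hb⟩ (hp _)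
      rw [cz] at this
      exact pos_of_mul_pos_left this (hpos z hz).le
    rw [cw, cz] at hsum
    refine le_of_mul_le_mul_left (hsum.trans (le_of_eq ?_)) cpos
    ring

/-- A Harnack inequality with the optimal weight: a bound `|1 + τ z| ≤ H |1 + τ w|` for all `τ ∈ D`
gives `v w ≤ H ^ (2s) v z` for every positive eigenfunction `v`. -/
lemma IsPositiveEigenfunction.harnack (hv : IsPositiveEigenfunction B s K v)
    (hs : 0 < s) (hB : ∀ b ∈ B, 1 ≤ b.re) (hne : B.Nonempty) (hKc : IsCompact K)
    (hD : baseDisc ⊆ K) (hK : ∀ z ∈ K, 0 ≤ z.re ∧ z.re ≤ 1 ∧ |z.im| ≤ 1 / 2)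
    {w z : ℂ} (hw : w ∈ K) (hz : z ∈ K) {H : ℝ}
    (hH : ∀ τ ∈ baseDisc, ‖1 + τ * z‖ ≤ H * ‖1 + τ * w‖) :
    v w ≤ H ^ (2 * s) * v z := by
  have H1 : 1 ≤ H := by simpa using hH 0 zero_mem_baseDisc
  have hvz := hv.2.1 z hz
  have main : ∀ ε : ℝ, 0 < ε → v w ≤ (1 + ε) * H ^ (2 * s) * v z := by
    intro ε hε
    obtain ⟨u, hu, humin⟩ := hKc.exists_isMinOn ⟨z, hz⟩ hv.1
    have hvu := hv.2.1 u hu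
    have huc := hKc.uniformContinuousOn_of_continuous hv.1
    rw [Metric.uniformContinuousOn_iff] at huc
    -- Scaling by the minimum of `v` turns the additive modulus into a multiplicative one.
    obtain ⟨δ, hδ, hδ'⟩ := huc (ε * v u) (by positivity)
    have hbd : ∀ a ∈ K, ‖a + 1‖ ≤ 3 := by
      intro a ha
      obtain ⟨h1, h2, h3⟩ := hK a ha
      calc ‖a + 1‖ ≤ |(a + 1).re| + |(a + 1).im| := Complex.norm_le_abs_re_add_abs_im _
        _ ≤ 3 := by
          simp only [Complex.add_re, Complex.one_re, Complex.add_im, Complex.one_im, add_zero]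
          rw [abs_of_nonneg (by linarith)]; linarith
    have hlb : ∀ a ∈ K, 1 ≤ ‖a + 1‖ := by
      intro a ha
      calc 1 ≤ (a + 1).re := by simpa using (hK a ha).1
        _ ≤ _ := Complex.re_le_norm _
    -- The product of norms is at most `9 < 10`.
    have h0 : ∀ w ∈ K, ∀ z ∈ K, ‖w - z‖ ≤ δ / 10 * (‖w + 1‖ * ‖z + 1‖) →
        v w ≤ (1 + ε) * v z := by
      intro w hw z hz hd
      have h9 : ‖w + 1‖ * ‖z + 1‖ ≤ 3 * 3 := by
        have := hbd w hw; have := hbd z hz; gcongr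
      have hlt : dist w z < δ := by
        rw [dist_eq_norm]
        calc ‖w - z‖ ≤ δ / 10 * (3 * 3) := hd.trans (by gcongr)
          _ < δ := by linarith
      have := hδ' w hw z hz hlt
      rw [Real.dist_eq] at this
      have h1 := (abs_lt.1 this).2
      have h2 : v u ≤ v z := humin hz
      have h3 := mul_le_mul_of_nonneg_left h2 hε.le
      linarith
    obtain ⟨n, hn⟩ := pow_unbounded_of_one_lt (‖w - z‖ / (δ / 10)) (one_lt_two (α := ℝ))
    refine hv.le_of_near hs hB hne hD hK hε (by positivity : 0 < δ / 10) h0 n w hw z hz H ?_ hH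
    rw [div_lt_iff₀ (by positivity)] at hn
    have h1 : 1 * 1 ≤ ‖w + 1‖ * ‖z + 1‖ :=
      mul_le_mul (hlb w hw) (hlb z hz) zero_le_one (by positivity)
    calc ‖w - z‖ ≤ δ / 10 * 2 ^ n * (1 * 1) := by linarith
      _ ≤ _ := by gcongr
  have hHp : 0 < H ^ (2 * s) * v z := by positivity
  refine le_of_forall_pos_le_add fun ε hε => ?_
  have := main (ε / (H ^ (2 * s) * v z)) (by positivity)
  refine this.trans (le_of_eq ?_)
  field_simp

end Eigenfunction

/-! ### Exponential growth bound relative to `v 0`. -/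

lemma one_add_sq_le_exp_mul {p q t : ℝ} (hp : 1 ≤ p) (ht : 0 ≤ t) :
    p ^ 2 + (q + t) ^ 2 ≤ Real.exp t * (p ^ 2 + q ^ 2) := by
  have h := Real.sum_le_exp_of_nonneg ht 4
  simp only [Finset.sum_range_succ, Finset.sum_range_zero, Nat.factorial] at h
  norm_num at h
  have hpq : 0 ≤ p ^ 2 + q ^ 2 := by positivity
  refine le_trans ?_ (mul_le_mul_of_nonneg_right h hpq)
  have hp2 : 1 ≤ p ^ 2 := by nlinarith
  -- For `p = 1`, the cubic Taylor minorant of `exp t` leaves `t` times this; the excess `p² - 1`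
  -- only helps.
  have key : 0 ≤ (1 - q) ^ 2 + t / 2 * (q ^ 2 - 1) + t ^ 2 / 6 * (1 + q ^ 2) := by
    nlinarith [sq_nonneg (t * (1 + q) / 4 - (1 - q)), sq_nonneg (t * (1 - q))]
  have h1 := mul_nonneg ht key
  have h2 : 0 ≤ (t + t ^ 2 / 2 + t ^ 3 / 6) * (p ^ 2 - 1) :=
    mul_nonneg (by positivity) (by linarith)
  nlinarith

/-- Write `τ = 1/δ` with `Re δ ≥ 1`, so `1 + τ w = (δ + w)/δ`. The real part of `w` only enlarges `δ
+ w`; the imaginary shift costs at most `exp |Im w|`. -/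
lemma one_le_exp_mul_norm_one_add_mul {τ w : ℂ} (hτ : τ ∈ baseDisc) (hw : 0 ≤ w.re) :
    1 ≤ Real.exp ‖w‖ * ‖1 + τ * w‖ ^ 2 := by
  by_cases h0 : τ = 0
  · simp [h0]
  obtain ⟨δ, rfl⟩ : ∃ δ : ℂ, τ = δ⁻¹ := ⟨τ⁻¹, by simp⟩
  have hδ : 1 ≤ δ.re := by simpa using one_le_inv_re_of_mem_baseDisc hτ h0
  have hδ0 := ne_zero_of_one_le_re hδ
  have e : 1 + δ⁻¹ * w = (δ + w) / δ := by field_simp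
  have hδp := norm_pos_iff.2 hδ0
  rw [e, norm_div, div_pow, ← mul_div_assoc, le_div_iff₀ (by positivity), one_mul, sq_norm_eq,
    sq_norm_eq]
  simp only [Complex.add_re, Complex.add_im]
  have hexp : Real.exp |w.im| ≤ Real.exp ‖w‖ := Real.exp_le_exp.2 (Complex.abs_im_le_norm w)
  have step : δ.re ^ 2 + δ.im ^ 2 ≤ Real.exp |w.im| * (δ.re ^ 2 + (δ.im + w.im) ^ 2) := by
    rcases le_total 0 w.im with h | h
    · have := one_add_sq_le_exp_mul (q := -(δ.im + w.im)) hδ h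
      rw [abs_of_nonneg h]
      convert this using 2 <;> ring
    · have := one_add_sq_le_exp_mul (q := δ.im + w.im) hδ (neg_nonneg.2 h)
      rw [abs_of_nonpos h]
      convert this using 2; ring
  refine step.trans ?_
  gcongr
  linarith

lemma IsPositiveEigenfunction.le_exp_mul {B K : Set ℂ} {s : ℝ} {v : ℂ → ℝ}
    (hv : IsPositiveEigenfunction B s K v)
    (hs : 0 < s) (hB : ∀ b ∈ B, 1 ≤ b.re) (hne : B.Nonempty) (hKc : IsCompact K)
    (hD : baseDisc ⊆ K) (hK : ∀ z ∈ K, 0 ≤ z.re ∧ z.re ≤ 1 ∧ |z.im| ≤ 1 / 2)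
    {w : ℂ} (hw : w ∈ K) : v w ≤ Real.exp (s * ‖w‖) * v 0 := by
  have := hv.harnack hs hB hne hKc hD hK hw (hD zero_mem_baseDisc) (H := Real.exp (‖w‖ / 2)) ?_
  · rwa [← Real.exp_mul, show ‖w‖ / 2 * (2 * s) = s * ‖w‖ by ring] at this
  · intro τ hτ
    have := one_le_exp_mul_norm_one_add_mul hτ (hK w hw).1
    rw [mul_zero, add_zero, norm_one]
    rw [show ‖w‖ = ‖w‖ / 2 + ‖w‖ / 2 by ring, Real.exp_add] at this
    exact (one_le_sq_iff₀ (by positivity)).1 (by linarith)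

/-! ### Lattice sums compared with integrals. -/

lemma tsum_le_setLIntegral {ι α : Type*} [Countable ι] [MeasurableSpace α]
    {μ : MeasureTheory.Measure α} {Q : ι → Set α} {S : Set α} {a : ι → ENNReal} {f : α → ENNReal}
    (hm : ∀ i, MeasurableSet (Q i)) (hd : Pairwise (Function.onFun Disjoint Q))
    (hμ : ∀ i, μ (Q i) = 1) (hS : ∀ i, Q i ⊆ S) (ha : ∀ i, ∀ x ∈ Q i, a i ≤ f x) :
    ∑' i, a i ≤ ∫⁻ x in S, f x ∂μ := by
  calc ∑' i, a i ≤ ∑' i, ∫⁻ x in Q i, f x ∂μ := by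
        refine ENNReal.tsum_le_tsum fun i => ?_
        calc a i = ∫⁻ _ in Q i, a i ∂μ := by simp [hμ]
          _ ≤ _ := MeasureTheory.setLIntegral_mono' (hm i) (ha i)
    _ = ∫⁻ x in ⋃ i, Q i, f x ∂μ := (MeasureTheory.lintegral_iUnion hm hd f).symm
    _ ≤ _ := MeasureTheory.lintegral_mono_set (Set.iUnion_subset hS)

lemma lintegral_Ioi_rpow_neg {a c : ℝ} (ha : 1 < a) (hc : 0 < c) :
    ∫⁻ t in Set.Ioi c, ENNReal.ofReal (t ^ (-a)) =
      ENNReal.ofReal (1 / (a - 1) * (1 / c) ^ (a - 1)) := by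
  rw [← MeasureTheory.ofReal_integral_eq_lintegral_ofReal
    (integrableOn_Ioi_rpow_of_lt (by linarith) hc), integral_Ioi_rpow_of_lt (by linarith) hc]
  · congr 1
    rw [one_div c, Real.inv_rpow hc.le, ← Real.rpow_neg hc.le,
      show -(a - 1) = -a + 1 by ring, show -a + 1 = -(a - 1) by ring]
    field_simp
  · filter_upwards [MeasureTheory.ae_restrict_mem measurableSet_Ioi] with t ht
    have : 0 < t := hc.trans ht
    simp only [Pi.zero_apply]
    positivity

lemma eq_of_mem_Ioc_sub_one {m n : ℤ} {x : ℝ} (hm : x ∈ Set.Ioc ((m : ℝ) - 1) m)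
    (hn : x ∈ Set.Ioc ((n : ℝ) - 1) n) : m = n := by
  have h1 : (m : ℝ) < n + 1 := by linarith [hm.1, hn.2]
  have h2 : (n : ℝ) < m + 1 := by linarith [hn.1, hm.2]
  have h1 : m < n + 1 := by exact_mod_cast h1
  have h2 : n < m + 1 := by exact_mod_cast h2
  omega

lemma tsum_rpow_neg_le {ι : Type*} {m : ι → ℤ} (hinj : Function.Injective m) {R a : ℝ}
    (hR : 1 < R) (ha : 1 < a) (hm : ∀ i, R < m i) :
    ∑' i, ENNReal.ofReal ((m i : ℝ) ^ (-a)) ≤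
      ENNReal.ofReal (1 / (a - 1) * (1 / (R - 1)) ^ (a - 1)) := by
  have := hinj.countable
  rw [← lintegral_Ioi_rpow_neg ha (by linarith : 0 < R - 1)]
  refine tsum_le_setLIntegral (Q := fun i => Set.Ioc ((m i : ℝ) - 1) (m i))
    (fun i => measurableSet_Ioc) ?_ (by simp) ?_ ?_
  · intro i j hij
    refine Set.disjoint_left.2 fun x hx hx' => hij (hinj (eq_of_mem_Ioc_sub_one hx hx'))
  · intro i x hx
    have := hm i
    simp only [Set.mem_Ioi]
    linarith [hx.1]
  · intro i x hx
    have := hm i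
    exact ENNReal.ofReal_le_ofReal
      (Real.rpow_le_rpow_of_nonpos (by linarith [hx.1]) hx.2 (by linarith))

/-- In polar coordinates: angle `π/2` times the integral of `r^(1 - 2s)` over `r > ρ`. -/
lemma lintegral_quadrant_le {s ρ : ℝ} (hs : 1 < s) (hρ : 0 < ρ) :
    ∫⁻ p in {p : ℝ × ℝ | 0 < p.1 ∧ 0 < p.2 ∧ ρ < √(p.1 ^ 2 + p.2 ^ 2)},
        ENNReal.ofReal (√(p.1 ^ 2 + p.2 ^ 2) ^ (-(2 * s))) ≤
      ENNReal.ofReal (Real.pi / 4 * (1 / (s - 1)) * (1 / ρ) ^ (2 * s - 2)) := by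
  have hmeas : MeasurableSet {p : ℝ × ℝ | 0 < p.1 ∧ 0 < p.2 ∧ ρ < √(p.1 ^ 2 + p.2 ^ 2)} := by
    have h1 : IsOpen {p : ℝ × ℝ | 0 < p.1} := isOpen_lt (by fun_prop) (by fun_prop)
    have h2 : IsOpen {p : ℝ × ℝ | 0 < p.2} := isOpen_lt (by fun_prop) (by fun_prop)
    have h3 : IsOpen {p : ℝ × ℝ | ρ < √(p.1 ^ 2 + p.2 ^ 2)} :=
      isOpen_lt (by fun_prop) (by fun_prop)
    exact (h1.inter (h2.inter h3)).measurableSet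
  rw [← MeasureTheory.lintegral_indicator hmeas, ← lintegral_comp_polarCoord_symm]
  have hT : MeasurableSet (Set.Ioi ρ ×ˢ Set.Ioo 0 (Real.pi / 2)) :=
    measurableSet_Ioi.prod measurableSet_Ioo
  calc _ ≤ ∫⁻ p in polarCoord.target, (Set.Ioi ρ ×ˢ Set.Ioo 0 (Real.pi / 2)).indicator
        (fun p : ℝ × ℝ => ENNReal.ofReal (p.1 ^ (-(2 * s - 1)))) p := by
        refine MeasureTheory.setLIntegral_mono' polarCoord.open_target.measurableSet ?_
        rintro ⟨r, θ⟩ ⟨hr, hθ⟩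
        simp only [Set.mem_Ioi] at hr
        have hrad : √((r * Real.cos θ) ^ 2 + (r * Real.sin θ) ^ 2) = r := by
          rw [show (r * Real.cos θ) ^ 2 + (r * Real.sin θ) ^ 2
            = r ^ 2 * (Real.cos θ ^ 2 + Real.sin θ ^ 2) by ring, Real.cos_sq_add_sin_sq, mul_one,
            Real.sqrt_sq hr.le]
        by_cases hmem : polarCoord.symm (r, θ) ∈
            {p : ℝ × ℝ | 0 < p.1 ∧ 0 < p.2 ∧ ρ < √(p.1 ^ 2 + p.2 ^ 2)}
        · rw [Set.indicator_of_mem hmem]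
          obtain ⟨hc, hsn, hlt⟩ := hmem
          simp only [polarCoord_symm_apply] at hc hsn hlt ⊢
          rw [hrad] at hlt ⊢
          have hc' := pos_of_mul_pos_right hc hr.le
          have hsn' := pos_of_mul_pos_right hsn hr.le
          have hθ0 : 0 < θ := by
            by_contra! h
            linarith [Real.sin_nonpos_of_nonpos_of_neg_pi_le h hθ.1.le]
          have hθ1 : θ < Real.pi / 2 := by
            by_contra! h
            linarith [Real.cos_nonpos_of_pi_div_two_le_of_le h
              (by linarith [hθ.2, Real.pi_pos])]
          rw [Set.indicator_of_mem (by exact ⟨hlt, hθ0, hθ1⟩), smul_eq_mul,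
            ← ENNReal.ofReal_mul hr.le]
          apply le_of_eq
          congr 1
          rw [show -(2 * s - 1) = 1 + -(2 * s) by ring, Real.rpow_add hr, Real.rpow_one]
        · rw [Set.indicator_of_notMem hmem]
          simp
    _ ≤ ∫⁻ p, (Set.Ioi ρ ×ˢ Set.Ioo 0 (Real.pi / 2)).indicator
        (fun p : ℝ × ℝ => ENNReal.ofReal (p.1 ^ (-(2 * s - 1)))) p :=
        MeasureTheory.setLIntegral_le_lintegral _ _
    _ = (∫⁻ r in Set.Ioi ρ, ENNReal.ofReal (r ^ (-(2 * s - 1)))) *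
        ∫⁻ _ in Set.Ioo 0 (Real.pi / 2), 1 := by
        rw [MeasureTheory.lintegral_indicator hT, MeasureTheory.Measure.volume_eq_prod,
          ← MeasureTheory.Measure.prod_restrict, ← MeasureTheory.lintegral_prod_mul]
        · simp
        · fun_prop
        · fun_prop
    _ = _ := by
        rw [lintegral_Ioi_rpow_neg (by linarith) hρ, MeasureTheory.setLIntegral_one,
          Real.volume_Ioo, ← ENNReal.ofReal_mul (by
            have : 0 < 2 * s - 1 - 1 := by linarith
            positivity)]
        congr 1
        rw [show 2 * s - 1 - 1 = 2 * s - 2 by ring]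
        have : s - 1 ≠ 0 := by linarith
        have e : (1 : ℝ) / (2 * s - 2) = 1 / 2 * (1 / (s - 1)) := by
          rw [show 2 * s - 2 = 2 * (s - 1) by ring]; field_simp
        rw [e]; ring

lemma tsum_quadrant_le {ι : Type*} {m n : ι → ℤ} (hinj : Function.Injective fun i => (m i, n i))
    {R s : ℝ} (hR : √2 < R) (hs : 1 < s) (hm : ∀ i, 1 ≤ m i) (hn : ∀ i, 1 ≤ n i)
    (h : ∀ i, R < √((m i : ℝ) ^ 2 + (n i : ℝ) ^ 2)) :
    ∑' i, ENNReal.ofReal (√((m i : ℝ) ^ 2 + (n i : ℝ) ^ 2) ^ (-(2 * s))) ≤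
      ENNReal.ofReal (Real.pi / 4 * (1 / (s - 1)) * (1 / (R - √2)) ^ (2 * s - 2)) := by
  have := hinj.countable
  refine le_trans ?_ (lintegral_quadrant_le hs (by linarith : 0 < R - √2))
  have hm' : ∀ i, (1 : ℝ) ≤ m i := fun i => by exact_mod_cast hm i
  have hn' : ∀ i, (1 : ℝ) ≤ n i := fun i => by exact_mod_cast hn i
  refine tsum_le_setLIntegral
    (Q := fun i => Set.Ioc ((m i : ℝ) - 1) (m i) ×ˢ Set.Ioc ((n i : ℝ) - 1) (n i))
    (fun i => measurableSet_Ioc.prod measurableSet_Ioc) ?_ ?_ ?_ ?_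
  · intro i j hij
    refine Set.disjoint_left.2 fun x hx hx' => hij (hinj ?_)
    exact Prod.ext (eq_of_mem_Ioc_sub_one hx.1 hx'.1) (eq_of_mem_Ioc_sub_one hx.2 hx'.2)
  · intro i
    rw [MeasureTheory.Measure.volume_eq_prod, MeasureTheory.Measure.prod_prod]
    simp
  · rintro i ⟨x, y⟩ ⟨hx, hy⟩
    obtain ⟨hx0, hx1⟩ := hx
    obtain ⟨hy0, hy1⟩ := hy
    have := hm' i
    have := hn' i
    simp only at hx0 hx1 hy0 hy1
    refine ⟨by simp only; linarith, by simp only; linarith, ?_⟩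
    simp only
    -- A unit cell has diameter `√2`, hence the radius `R - √2`.
    have tri : √((m i : ℝ) ^ 2 + (n i : ℝ) ^ 2) ≤ √(x ^ 2 + y ^ 2) + √2 := by
      apply Real.sqrt_le_iff.2 ⟨by positivity, ?_⟩
      have hxy : x + y ≤ √(x ^ 2 + y ^ 2) * √2 := by
        rw [← Real.sqrt_mul (by positivity)]
        apply Real.le_sqrt_of_sq_le
        nlinarith [sq_nonneg (x - y)]
      have e1 := Real.sq_sqrt (by positivity : 0 ≤ x ^ 2 + y ^ 2)
      have e2 := Real.sq_sqrt (by positivity : (0 : ℝ) ≤ 2)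
      have q1 : (m i : ℝ) ^ 2 ≤ (x + 1) ^ 2 := by
        apply pow_le_pow_left₀ <;> linarith
      have q2 : (n i : ℝ) ^ 2 ≤ (y + 1) ^ 2 := by
        apply pow_le_pow_left₀ <;> linarith
      rw [add_sq, e1, e2]
      linarith
    linarith [h i]
  · rintro i ⟨x, y⟩ ⟨hx, hy⟩
    obtain ⟨hx0, hx1⟩ := hx
    obtain ⟨hy0, hy1⟩ := hy
    have := hm' i
    have := hn' i
    simp only at hx0 hx1 hy0 hy1 ⊢
    have hx : 0 < x := by linarith
    have hy : 0 < y := by linarith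
    refine ENNReal.ofReal_le_ofReal (Real.rpow_le_rpow_of_nonpos (by positivity) ?_ (by linarith))
    gcongr

lemma norm_intCast_add_mul_I (m n : ℤ) :
    ‖(m : ℂ) + (n : ℂ) * Complex.I‖ = √((m : ℝ) ^ 2 + (n : ℝ) ^ 2) := by
  rw [← Real.sqrt_sq (norm_nonneg _), sq_norm_eq]
  simp

/-- The sum over one open quadrant: `σ = 1` is the upper one, `σ = -1` the lower one. -/
lemma tsum_norm_quadrant_le {A : Set ℂ} {R s : ℝ} (hR : √2 < R) (hs : 1 < s) {σ : ℤ}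
    (hσ : σ ^ 2 = 1)
    (hA : ∀ b ∈ A, R < ‖b‖ ∧ ∃ m n : ℤ, 1 ≤ m ∧ 1 ≤ σ * n ∧ b = (m : ℂ) + (n : ℂ) * Complex.I) :
    ∑' b : A, ENNReal.ofReal (‖(b : ℂ)‖ ^ (-(2 * s))) ≤
      ENNReal.ofReal (Real.pi / 4 * (1 / (s - 1)) * (1 / (R - √2)) ^ (2 * s - 2)) := by
  choose hlt m n hm hn heq using fun b : A => hA b b.2
  have hσ' : ((σ : ℤ) : ℝ) ^ 2 = 1 := by exact_mod_cast hσ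
  have hnorm : ∀ b : A, ‖(b : ℂ)‖ = √((m b : ℝ) ^ 2 + ((σ * n b : ℤ) : ℝ) ^ 2) := by
    intro b
    conv_lhs => rw [heq b]
    rw [norm_intCast_add_mul_I]
    push_cast
    rw [mul_pow, hσ', one_mul]
  have hinj : Function.Injective fun b : A => (m b, σ * n b) := by
    intro b b' h
    simp only [Prod.mk.injEq] at h
    have h2 : n b = n b' := by
      have hne : σ ≠ 0 := by rintro rfl; norm_num at hσ
      exact mul_left_cancel₀ hne h.2
    apply Subtype.ext
    rw [heq b, heq b', h.1, h2]
  simp_rw [hnorm]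
  exact tsum_quadrant_le hinj hR hs hm hn fun b => (hnorm b) ▸ hlt b

lemma tsum_norm_ray_le {A : Set ℂ} {R s : ℝ} (hR : 1 < R) (hs : 1 < s)
    (hA : ∀ b ∈ A, R < ‖b‖ ∧ ∃ m : ℤ, 1 ≤ m ∧ b = (m : ℂ)) :
    ∑' b : A, ENNReal.ofReal (‖(b : ℂ)‖ ^ (-(2 * s))) ≤
      ENNReal.ofReal (1 / (2 * s - 1) * (1 / (R - 1)) ^ (2 * s - 1)) := by
  choose hlt m hm heq using fun b : A => hA b b.2
  have hnorm : ∀ b : A, ‖(b : ℂ)‖ = m b := by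
    intro b
    have : (0 : ℝ) ≤ m b := by exact_mod_cast zero_le_one.trans (hm b)
    conv_lhs => rw [heq b]
    rw [Complex.norm_intCast, abs_of_nonneg this]
  simp_rw [hnorm]
  refine tsum_rpow_neg_le ?_ hR (by linarith) fun b => (hnorm b) ▸ hlt b
  intro b b' h
  apply Subtype.ext
  rw [heq b, heq b', h]

lemma tsum_indexSetTwo_le {R s : ℝ} (hR : 2 < R) (hs : 1 < s) :
    ∑' b : {b : ℂ // b ∈ indexSetTwo ∧ R < ‖b‖}, ENNReal.ofReal (‖(b : ℂ)‖ ^ (-(2 * s))) ≤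
      ENNReal.ofReal (Real.pi / 4 * (1 / (s - 1)) * (1 / (R - √2)) ^ (2 * s - 2)) := by
  have h2 : √2 < R := (Real.sqrt_lt' (by linarith)).2 (by nlinarith)
  refine tsum_norm_quadrant_le (A := {b : ℂ | b ∈ indexSetTwo ∧ R < ‖b‖}) h2 hs
    (σ := -1) (by norm_num) ?_
  rintro b ⟨⟨m, n, hm, hn, rfl⟩, hlt⟩
  exact ⟨hlt, m, n, by omega, by omega, by simp⟩

/-- The real ray gives the first summand; the two open quadrants double `π/4`. -/
lemma tsum_indexSetOne_le {R s : ℝ} (hR : 2 < R) (hs : 1 < s) :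
    ∑' b : {b : ℂ // b ∈ indexSetOne ∧ R < ‖b‖}, ENNReal.ofReal (‖(b : ℂ)‖ ^ (-(2 * s))) ≤
      ENNReal.ofReal (1 / (2 * s - 1) * (1 / (R - 1)) ^ (2 * s - 1) +
        Real.pi / 2 * (1 / (s - 1)) * (1 / (R - √2)) ^ (2 * s - 2)) := by
  have h2 : √2 < R := (Real.sqrt_lt' (by linarith)).2 (by nlinarith)
  let A : (ℤ → Prop) → Set ℂ := fun P =>
    {b | R < ‖b‖ ∧ ∃ m n : ℤ, 1 ≤ m ∧ P n ∧ b = (m : ℂ) + (n : ℂ) * Complex.I}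
  have hsub : {b : ℂ | b ∈ indexSetOne ∧ R < ‖b‖} ⊆
      A (fun n => n = 0) ∪ (A (fun n => 1 ≤ 1 * n) ∪ A (fun n => 1 ≤ -1 * n)) := by
    rintro b ⟨⟨m, n, hm, rfl⟩, hlt⟩
    have e : ((m : ℕ) : ℂ) = ((m : ℤ) : ℂ) := by simp
    rcases lt_trichotomy n 0 with h | h | h
    · exact Or.inr (Or.inr ⟨hlt, m, n, by omega, by omega, by rw [e]⟩)
    · exact Or.inl ⟨hlt, m, n, by omega, h, by rw [e]⟩
    · exact Or.inr (Or.inl ⟨hlt, m, n, by omega, by omega, by rw [e]⟩)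
  have q : 0 ≤ Real.pi / 4 * (1 / (s - 1)) * (1 / (R - √2)) ^ (2 * s - 2) := by
    have : 0 < s - 1 := by linarith
    have : 0 < R - √2 := by linarith
    positivity
  have r : 0 ≤ 1 / (2 * s - 1) * (1 / (R - 1)) ^ (2 * s - 1) := by
    have : 0 < 2 * s - 1 := by linarith
    have : 0 < R - 1 := by linarith
    positivity
  have h0 := tsum_norm_ray_le (A := A (fun n => n = 0)) (by linarith : 1 < R) hs (by
    rintro b ⟨hlt, m, n, hm, rfl, hb⟩
    exact ⟨hlt, m, hm, by simpa using hb⟩)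
  have h1 := tsum_norm_quadrant_le (A := A (fun n => 1 ≤ 1 * n)) h2 hs (σ := 1) (by norm_num)
    (fun b hb => hb)
  have h3 := tsum_norm_quadrant_le (A := A (fun n => 1 ≤ -1 * n)) h2 hs (σ := -1) (by norm_num)
    (fun b hb => hb)
  let f : ℂ → ENNReal := fun b => ENNReal.ofReal (‖b‖ ^ (-(2 * s)))
  refine (ENNReal.tsum_mono_subtype f hsub).trans ((ENNReal.tsum_union_le f _ _).trans
    ((add_le_add h0 ((ENNReal.tsum_union_le f _ _).trans (add_le_add h1 h3))).trans
      (le_of_eq ?_)))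
  rw [← ENNReal.ofReal_add q q, ← ENNReal.ofReal_add r (add_nonneg q q)]
  congr 1; ring

/-! ### Termwise bound and the tail estimate. -/

lemma indexSetTwo_subset : indexSetTwo ⊆ indexSetOne := by
  rintro b ⟨m, n, hm, -, rfl⟩
  exact ⟨m, n, hm, rfl⟩

lemma one_le_re_of_mem_indexSetOne {b : ℂ} (hb : b ∈ indexSetOne) : 1 ≤ b.re := by
  obtain ⟨m, n, hm, rfl⟩ := hb
  simpa using hm

lemma sq_norm_sub_norm_le {z b : ℂ} (hz : 0 ≤ z.re) (hi : |z.im| ≤ 1 / 2)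
    (hb : 0 ≤ b.re) : ‖b‖ ^ 2 - ‖b‖ ≤ ‖z + b‖ ^ 2 := by
  have h1 : |b.im| ≤ ‖b‖ := Complex.abs_im_le_norm b
  have h2 : -(|z.im| * |b.im|) ≤ z.im * b.im := by
    rw [← abs_mul]; exact neg_abs_le _
  have h3 : |z.im| * |b.im| ≤ 1 / 2 * |b.im| := by gcongr
  rw [sq_norm_eq b, sq_norm_eq (z + b)]
  simp only [Complex.add_re, Complex.add_im]
  nlinarith [mul_nonneg hz hb, sq_nonneg z.re, sq_nonneg z.im]

lemma IsPositiveEigenfunction.transferTerm_le {B K : Set ℂ} {s R : ℝ} {v : ℂ → ℝ}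
    (hv : IsPositiveEigenfunction B s K v) (hs : 0 < s) (hR : 1 < R)
    (hB : ∀ b ∈ B, 1 ≤ b.re) (hKc : IsCompact K)
    (hD : baseDisc ⊆ K) (hK : ∀ z ∈ K, 0 ≤ z.re ∧ z.re ≤ 1 ∧ |z.im| ≤ 1 / 2)
    {z b : ℂ} (hz : z ∈ K) (hb : b ∈ B) (hRb : R < ‖b‖) :
    transferTerm s v z b ≤
      Real.exp (s / √(R ^ 2 - R)) * (R / (R - 1)) ^ s * v 0 * ‖b‖ ^ (-(2 * s)) := by
  have hv0 := hv.2.1 0 (hD zero_mem_baseDisc)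
  have hbpos : 0 < ‖b‖ := by linarith
  have hlow := sq_norm_sub_norm_le (hK z hz).1 (hK z hz).2.2 (zero_le_one.trans (hB b hb))
  have hzb : 0 < ‖z + b‖ := norm_pos_iff.2 (ne_zero_of_one_le_re (by
    simp only [Complex.add_re]; linarith [(hK z hz).1, hB b hb]))
  have hRR : 0 < R ^ 2 - R := by nlinarith
  have hθ : ‖moebiusTheta b z‖ ≤ 1 / √(R ^ 2 - R) := by
    rw [moebiusTheta, norm_div, norm_one]
    refine one_div_le_one_div_of_le (Real.sqrt_pos.2 hRR) ?_
    refine Real.sqrt_le_iff.2 ⟨hzb.le, ?_⟩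
    nlinarith
  have hval : v (moebiusTheta b z) ≤ Real.exp (s / √(R ^ 2 - R)) * v 0 := by
    refine (hv.le_exp_mul hs hB ⟨b, hb⟩ hKc hD hK
      (moebiusTheta_mem hD (hK z hz).1 (hB b hb))).trans ?_
    have : s * ‖moebiusTheta b z‖ ≤ s / √(R ^ 2 - R) := by
      rw [div_eq_mul_one_div]; gcongr
    gcongr
  have hR1 : 0 < R - 1 := by linarith
  have hwt : 1 / ‖z + b‖ ^ (2 * s) ≤ (R / (R - 1)) ^ s * ‖b‖ ^ (-(2 * s)) := by
    -- Since `|z + b|² ≥ |b|² - |b|` and `|b| / (|b| - 1) ≤ R / (R - 1)` for `|b| > R`.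
    have h1 : ‖b‖ ^ 2 ≤ R / (R - 1) * ‖z + b‖ ^ 2 := by
      rw [div_mul_eq_mul_div, le_div_iff₀ hR1]
      nlinarith
    have h2 := Real.rpow_le_rpow (by positivity) h1 hs.le
    rw [Real.mul_rpow (by positivity) (by positivity), ← Real.rpow_natCast_mul hbpos.le,
      ← Real.rpow_natCast_mul hzb.le] at h2
    push_cast at h2
    rw [Real.rpow_neg hbpos.le, ← div_eq_mul_inv, div_le_div_iff₀ (by positivity) (by positivity),
      one_mul]
    exact h2
  have hvθ := hv.2.1 _ (moebiusTheta_mem hD (hK z hz).1 (hB b hb))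
  calc transferTerm s v z b
      ≤ ((R / (R - 1)) ^ s * ‖b‖ ^ (-(2 * s))) * (Real.exp (s / √(R ^ 2 - R)) * v 0) := by
        unfold transferTerm; gcongr
    _ = _ := by ring

lemma IsPositiveEigenfunction.tsum_tail_le {B K : Set ℂ} {s R C : ℝ} {v : ℂ → ℝ}
    (hv : IsPositiveEigenfunction B s K v) (hs : 0 < s) (hR : 1 < R)
    (hB : ∀ b ∈ B, 1 ≤ b.re) (hKc : IsCompact K)
    (hD : baseDisc ⊆ K) (hK : ∀ z ∈ K, 0 ≤ z.re ∧ z.re ≤ 1 ∧ |z.im| ≤ 1 / 2) (hC : 0 ≤ C)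
    (htail : ∑' b : {b : ℂ // b ∈ B ∧ R < ‖b‖}, ENNReal.ofReal (‖(b : ℂ)‖ ^ (-(2 * s))) ≤
      ENNReal.ofReal C) {z : ℂ} (hz : z ∈ K) :
    Summable (fun b : {b : ℂ // b ∈ B ∧ R < ‖b‖} => transferTerm s v z b) ∧
      ∑' b : {b : ℂ // b ∈ B ∧ R < ‖b‖}, transferTerm s v z b ≤
        Real.exp (s / √(R ^ 2 - R)) * (R / (R - 1)) ^ s * C * v 0 := by
  have hv0 := hv.2.1 0 (hD zero_mem_baseDisc)
  have hR1 : 0 < R - 1 := by linarith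
  set E := Real.exp (s / √(R ^ 2 - R)) * (R / (R - 1)) ^ s * v 0 with hE
  have hE0 : 0 ≤ E := by positivity
  obtain ⟨c, hc⟩ := hv.2.2
  -- A subfamily of the convergent series for `L_s v`.
  have hsum : Summable (fun b : {b : ℂ // b ∈ B ∧ R < ‖b‖} => transferTerm s v z b) :=
    (hc z hz).1.comp_injective
      (i := fun b : {b : ℂ // b ∈ B ∧ R < ‖b‖} => (⟨b, b.2.1⟩ : B))
      fun a b h => Subtype.ext (congrArg (fun x : B => (x : ℂ)) h)
  refine ⟨hsum, ?_⟩
  have hnn : ∀ b : {b : ℂ // b ∈ B ∧ R < ‖b‖}, 0 ≤ transferTerm s v z b := by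
    rintro ⟨b, hb, -⟩
    have := hv.2.1 _ (moebiusTheta_mem hD (hK z hz).1 (hB b hb))
    simp only [transferTerm]
    positivity
  rw [show Real.exp (s / √(R ^ 2 - R)) * (R / (R - 1)) ^ s * C * v 0 = E * C by rw [hE]; ring,
    ← ENNReal.ofReal_le_ofReal_iff (by positivity), ENNReal.ofReal_tsum_of_nonneg hnn hsum,
    ENNReal.ofReal_mul hE0]
  refine le_trans ?_ (mul_le_mul_right htail _)
  rw [← ENNReal.tsum_mul_left]
  refine ENNReal.tsum_le_tsum fun b => ?_
  rw [← ENNReal.ofReal_mul hE0]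
  exact ENNReal.ofReal_le_ofReal (hv.transferTerm_le hs hR hB hKc hD hK hz b.2.1 b.2.2)

theorem theorem5p12 (s R : ℝ) (hs : 1 < s) (hR : 2 < R)
    (U : Set ℂ) (hU : IsOpen U) (hD : baseDisc ⊆ closure U)
    (hstrip : ∀ z ∈ closure U, 0 ≤ z.re ∧ z.re ≤ 1 ∧ |z.im| ≤ 1 / 2) :
    (∀ v : ℂ → ℝ, IsPositiveEigenfunction indexSetOne s (closure U) v →
      ∀ z ∈ closure U,
        Summable (fun b : {b : ℂ // b ∈ indexSetOne ∧ R < ‖b‖} => transferTerm s v z b) ∧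
        ∑' b : {b : ℂ // b ∈ indexSetOne ∧ R < ‖b‖}, transferTerm s v z b ≤
          Real.exp (s / √(R ^ 2 - R)) * (R / (R - 1)) ^ s *
            (1 / (2 * s - 1) * (1 / (R - 1)) ^ (2 * s - 1) +
              Real.pi / 2 * (1 / (s - 1)) * (1 / (R - √2)) ^ (2 * s - 2)) * v 0) ∧
    (∀ v : ℂ → ℝ, IsPositiveEigenfunction indexSetTwo s (closure U) v →
      ∀ z ∈ closure U,
        Summable (fun b : {b : ℂ // b ∈ indexSetTwo ∧ R < ‖b‖} => transferTerm s v z b) ∧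
        ∑' b : {b : ℂ // b ∈ indexSetTwo ∧ R < ‖b‖}, transferTerm s v z b ≤
          Real.exp (s / √(R ^ 2 - R)) * (R / (R - 1)) ^ s *
            (Real.pi / 4 * (1 / (s - 1)) * (1 / (R - √2)) ^ (2 * s - 2)) * v 0) := by
  have hKc : IsCompact (closure U) := by
    refine Metric.isCompact_of_isClosed_isBounded isClosed_closure ?_
    refine (Metric.isBounded_closedBall (x := (0 : ℂ)) (r := 2)).subset fun z hz => ?_
    obtain ⟨h1, h2, h3⟩ := hstrip z hz
    rw [mem_closedBall_zero_iff]
    refine (Complex.norm_le_abs_re_add_abs_im z).trans ?_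
    rw [abs_of_nonneg h1]
    linarith
  have hs1 : 0 < s - 1 := by linarith
  have hs2 : 0 < 2 * s - 1 := by linarith
  have hR1 : 0 < R - 1 := by linarith
  have hR2 : 0 < R - √2 := sub_pos.2 ((Real.sqrt_lt' (by linarith)).2 (by nlinarith))
  constructor
  · intro v hv z hz
    exact hv.tsum_tail_le (by linarith) (by linarith) (fun _ => one_le_re_of_mem_indexSetOne) hKc
      hD hstrip (by positivity) (tsum_indexSetOne_le hR hs) hz
  · intro v hv z hz
    exact hv.tsum_tail_le (by linarith) (by linarith)
      (fun _ h => one_le_re_of_mem_indexSetOne (indexSetTwo_subset h)) hKc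
      hD hstrip (by positivity) (tsum_indexSetTwo_le hR hs) hz
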